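/- All matroids are finite. The size-rank-coloop data of a matroid $M=(E,r)$ is the multiset of triples $(|S|,r(S),c(S))$ over all $S\subseteq E$, where $c(S)$ is the number of coloops of the restriction $M|S$. The Tutte polynomial is $T(M;x,y)=\sum_{S\subseteq E}(x-1)^{r(E)-r(S)}(y-1)^{|S|-r(S)}$. Let $M=(E,r)$ be a loopless matroid and let $m\ge 1$ be an integer. For each $e\in E$ let $T_e$ be a set of size $m$, where the sets $T_e$ are pairwise disjoint and disjoint from $E$, and let $a$ be an element that is neither in $E$ nor in any $T_e$. For $S\subseteq E$ put $q(S)=S\cup\{a\}\cup\bigcup_{e\in S}T_e$. The free $m$-cone $Q_m(M)$ is the unique matroid on $q(E)$ whose cyclic flats (the flats to which the restriction has no coloops) are the cyclic flats of $M$, each with its rank in $M$, and the sets $q(F)$, with $F$ a nonempty flat of $M$, where $q(F)$ has rank $r(F)+1$. **Corollary 5.2.** Let $m\ge 1$, let $M$ be a loopless matroid on $E$, and let $Q=Q_m(M)$. For each given $m$, the Tutte polynomials of $Q\setminus a$, of $Q\setminus E$, and of $Q\setminus(E\cup a)$ are each determined by the size-rank-coloop data of $M$. That is, if $M$ and $N$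 are loopless matroids on $E$ and $E'$ with the same size-rank-coloop data, and $a$ and $a'$ are the tips of $Q=Q_m(M)$ and $Q'=Q_m(N)$, then $T(Q\setminus a;x,y)=T(Q'\setminus a';x,y)$, $T(Q\setminus E;x,y)=T(Q'\setminus E';x,y)$, and $T(Q\setminus(E\cup a);x,y)=T(Q'\setminus(E'\cup a');x,y)$. -/

import Mathlib

open scoped Matroid

namespace Matroid

/-- A *cyclic flat* of `M`: a flat `A` such that the restriction of `M` to `A` has no coloops. -/
def IsCyclicFlat {α : Type*} (M : Matroid α) (A : Set α) : Prop :=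
  M.IsFlat A ∧ (M ↾ A).coloops = ∅

/-- The *size-rank-coloop data* of a finite matroid `M`: the multiset of the triples
`(|S|, r(S), c(S))` over all subsets `S` of the ground set, where `c(S)` is the number of
coloops of the restriction of `M` to `S`. -/
noncomputable def sizeRankColoopData {α : Type*} (M : Matroid α) [M.Finite] :
    Multiset (ℕ × ℕ × ℕ) :=
  M.ground_finite.toFinset.powerset.val.map fun (S : Finset α) =>
    (S.card, (M.eRk (S : Set α)).toNat, (M ↾ (S : Set α)).coloops.ncard)

/-- The *Tutte polynomial* of a finite matroid `M`, in the variables `x = X 0` and `y = X 1`: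
the sum of `(x - 1) ^ (r(M) - r(S)) * (y - 1) ^ (|S| - r(S))` over all subsets `S` of the ground
set. (The exponents are differences in `ℕ`; as `r(S) ≤ r(M)` and `r(S) ≤ |S|`, none of them is
truncated.) -/
noncomputable def tuttePolynomial {α : Type*} (M : Matroid α) [M.Finite] :
    MvPolynomial (Fin 2) ℤ :=
  ∑ S ∈ M.ground_finite.toFinset.powerset,
    (MvPolynomial.X 0 - 1) ^ (M.eRank.toNat - (M.eRk (S : Set α)).toNat) *
      (MvPolynomial.X 1 - 1) ^ (S.card - (M.eRk (S : Set α)).toNat)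

end Matroid

/-- Labels for the elements of the free `m`-cone of a matroid whose elements are in `α`: the
original elements `base e`, the `m` new elements `copy e i` that form the set `T_e`, and the
tip. -/
inductive ConeElt (α : Type*) (m : ℕ)
  | base (e : α) : ConeElt α m
  | copy (e : α) (i : Fin m) : ConeElt α m
  | tip : ConeElt α m

namespace Matroid

open Set

/-- The cone `q(S)` of a set `S`: the union of `S`, the tip, and the sets `T_e` with `e ∈ S`. -/
def coneSet {α : Type*} (m : ℕ) (S : Set α) : Set (ConeElt α m) :=
  {x | x = ConeElt.tip ∨ ∃ e ∈ S, x = ConeElt.base e ∨ ∃ i, x = ConeElt.copy e i}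

/-- `Q` is the free `m`-cone of `M`: its ground set is the union of `E(M)`, the sets `T_e` and
the tip; its cyclic flats are the cyclic flats of `M`, with the same rank as in `M`, and the
cones `q(F)` of the nonempty flats `F` of `M`, where `q(F)` has rank `r(F) + 1`. -/
structure IsFreeCone {α : Type*} (M : Matroid α) (m : ℕ) (Q : Matroid (ConeElt α m)) : Prop where
  ground_eq : Q.E = coneSet m M.E
  isCyclicFlat_iff : ∀ Z, Q.IsCyclicFlat Z ↔
    (∃ X, M.IsCyclicFlat X ∧ Z = ConeElt.base '' X) ∨
      ∃ F, M.IsFlat F ∧ F.Nonempty ∧ Z = coneSet m F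
  eRk_base : ∀ X, M.IsCyclicFlat X → Q.eRk (ConeElt.base '' X) = M.eRk X
  eRk_cone : ∀ F, M.IsFlat F → F.Nonempty → Q.eRk (coneSet m F) = M.eRk F + 1

/-! Existence and uniqueness of the free `m`-cone. -/

theorem isCyclicFlat_iff_closure {α : Type*} {M : Matroid α} {A : Set α} :
    M.IsCyclicFlat A ↔ M.IsFlat A ∧ ∀ x ∈ A, x ∈ M.closure (A \ {x}) := by
  unfold IsCyclicFlat
  refine and_congr_right fun hA => ?_
  rw [Set.eq_empty_iff_forall_notMem]
  refine forall_congr' fun x => ?_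
  rw [← isColoop_iff_mem_coloops, restrict_isColoop_iff hA.subset_ground]
  tauto

theorem IsCircuit.isCyclicFlat_closure {α : Type*} {M : Matroid α} {C : Set α}
    (hC : M.IsCircuit C) : M.IsCyclicFlat (M.closure C) := by
  rw [isCyclicFlat_iff_closure]
  refine ⟨isFlat_closure C, fun x hx => ?_⟩
  have hsub : C ⊆ M.closure C := M.subset_closure C hC.subset_ground
  by_cases hxC : x ∈ C
  · exact M.closure_subset_closure (sdiff_subset_sdiff_left hsub)
      (hC.mem_closure_sdiff_singleton_of_mem hxC)
  · exact M.closure_subset_closure (subset_sdiff_singleton hsub hxC) hx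

theorem Indep.of_cyclicFlats {α : Type*} {M N : Matroid α} [M.Finite] (hE : M.E = N.E)
    (h : ∀ Z, N.IsCyclicFlat Z → N.eRk Z = M.eRk Z) {I : Set α} (hI : M.Indep I) :
    N.Indep I := by
  by_contra hcon
  have hdep : N.Dep I := ⟨hcon, hE ▸ hI.subset_ground⟩
  obtain ⟨C, hCI, hC⟩ := hdep.exists_isCircuit_subset
  obtain ⟨x, hx⟩ := hC.nonempty
  have h1 := h _ hC.isCyclicFlat_closure
  rw [eRk_closure_eq, (hC.sdiff_singleton_isBasis hx).eRk_eq_encard] at h1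
  have h2 : C.encard ≤ M.eRk (N.closure C) :=
    (hI.subset hCI).encard_le_eRk_of_subset (N.subset_closure C hC.subset_ground)
  rw [← h1, ← encard_sdiff_singleton_add_one hx] at h2
  have hfin : (C \ {x}).Finite := (M.set_finite C (hE ▸ hC.subset_ground)).sdiff
  rw [hfin.encard_eq_coe_toFinset_card] at h2
  norm_cast at h2
  omega

theorem IsFreeCone.unique {α : Type*} {M : Matroid α} [M.Finite] {m : ℕ}
    {Q Q' : Matroid (ConeElt α m)} [Q.Finite] [Q'.Finite] (hQ : M.IsFreeCone m Q)
    (hQ' : M.IsFreeCone m Q') : Q = Q' := by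
  have hE : Q.E = Q'.E := hQ.ground_eq.trans hQ'.ground_eq.symm
  have hr : ∀ Z, Q.IsCyclicFlat Z → Q.eRk Z = Q'.eRk Z := by
    intro Z hZ
    rcases (hQ.isCyclicFlat_iff Z).1 hZ with ⟨X, hX, rfl⟩ | ⟨F, hF, hF0, rfl⟩
    · rw [hQ.eRk_base X hX, hQ'.eRk_base X hX]
    · rw [hQ.eRk_cone F hF hF0, hQ'.eRk_cone F hF hF0]
  have hr' : ∀ Z, Q'.IsCyclicFlat Z → Q'.eRk Z = Q.eRk Z := fun Z hZ =>
    (hr Z ((hQ.isCyclicFlat_iff Z).2 ((hQ'.isCyclicFlat_iff Z).1 hZ))).symm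
  exact ext_indep hE fun I _ =>
    ⟨fun hI => hI.of_cyclicFlats hE hr', fun hI => hI.of_cyclicFlats hE.symm hr⟩

/-- The elementary lift of a finite matroid `N` in which each element of `D` gets a generic new
coordinate. -/
noncomputable def genericLift {γ : Type*} (N : Matroid γ) [N.Finite] (D : Set γ) : Matroid γ :=
  (IndepMatroid.ofFinite N.ground_finite
    (fun I => I ⊆ N.E ∧ (N.Indep I ∨ ∃ x ∈ I, x ∈ D ∧ N.Indep (I \ {x})))
    ⟨empty_subset _, Or.inl N.empty_indep⟩
    (by
      rintro I J ⟨hJE, hJ⟩ hIJ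
      refine ⟨hIJ.trans hJE, ?_⟩
      rcases hJ with hJ | ⟨x, hxJ, hxD, hJ⟩
      · exact Or.inl (hJ.subset hIJ)
      · by_cases hxI : x ∈ I
        · exact Or.inr ⟨x, hxI, hxD, hJ.subset (sdiff_subset_sdiff_left hIJ)⟩
        · exact Or.inl (hJ.subset (subset_sdiff_singleton hIJ hxI)))
    (by
      rintro I J ⟨hIE, hI⟩ ⟨hJE, hJ⟩ hlt
      have hIf := N.set_finite I hIE
      have hJf := N.set_finite J hJE
      have aug : ∀ A B : Set γ, N.Indep A → N.Indep B → A.ncard < B.ncard →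
          ∃ z ∈ B, z ∉ A ∧ N.Indep (insert z A) := by
        intro A B hA hB hAB
        have hAf := N.set_finite A hA.subset_ground
        have hBf := N.set_finite B hB.subset_ground
        have hle : A.encard < B.encard := by
          rw [← hAf.cast_ncard_eq, ← hBf.cast_ncard_eq]
          exact_mod_cast hAB
        obtain ⟨z, hz, hzi⟩ := hA.augment hB hle
        exact ⟨z, hz.1, hz.2, hzi⟩
      have case1 : N.Indep I → ∃ e ∈ J, e ∉ I ∧ insert e I ⊆ N.E ∧
          (N.Indep (insert e I) ∨
            ∃ x ∈ insert e I, x ∈ D ∧ N.Indep (insert e I \ {x})) := by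
        intro hI
        rcases hJ with hJ | ⟨y, hyJ, hyD, hJ⟩
        · obtain ⟨z, hzJ, hzI, hz⟩ := aug I J hI hJ hlt
          exact ⟨z, hzJ, hzI, hz.subset_ground, Or.inl hz⟩
        · by_cases hyI : y ∈ I
          · have h1 := ncard_sdiff_singleton_lt_of_mem hyI hIf
            have h2 := ncard_sdiff_singleton_add_one hyJ hJf
            obtain ⟨z, hzJ, hzI, hz⟩ := aug (I \ {y}) (J \ {y}) (hI.subset sdiff_subset) hJ
              (by omega)
            have hzy : z ≠ y := hzJ.2
            refine ⟨z, hzJ.1, fun h => hzI ⟨h, hzy⟩,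
              insert_subset (hJE hzJ.1) hIE, Or.inr ⟨y, Or.inr hyI, hyD, ?_⟩⟩
            rwa [insert_sdiff_of_notMem _ (by simpa using hzy)]
          · refine ⟨y, hyJ, hyI, insert_subset (hJE hyJ) hIE,
              Or.inr ⟨y, Or.inl rfl, hyD, ?_⟩⟩
            rwa [insert_sdiff_self_of_notMem hyI]
      by_cases hNI : N.Indep I
      · exact case1 hNI
      rcases hI with hI | ⟨x, hxI, hxD, hI⟩
      · exact absurd hI hNI
      have hJ0 : ∃ J0 ⊆ J, N.Indep J0 ∧ J.ncard ≤ J0.ncard + 1 := by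
        rcases hJ with hJ | ⟨y, hyJ, hyD, hJ⟩
        · exact ⟨J, Subset.rfl, hJ, by omega⟩
        · exact ⟨J \ {y}, sdiff_subset, hJ, (ncard_sdiff_singleton_add_one hyJ hJf).ge⟩
      obtain ⟨J0, hJ0J, hJ0, hcard⟩ := hJ0
      have h1 := ncard_sdiff_singleton_add_one hxI hIf
      obtain ⟨z, hzJ, hzI, hz⟩ := aug (I \ {x}) J0 hI hJ0 (by omega)
      by_cases hzx : z = x
      · subst hzx
        rw [insert_sdiff_singleton, insert_eq_of_mem hxI] at hz
        exact absurd hz hNI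
      · refine ⟨z, hJ0J hzJ, fun h => hzI ⟨h, hzx⟩, insert_subset (hJE (hJ0J hzJ)) hIE,
          Or.inr ⟨x, Or.inr hxI, hxD, ?_⟩⟩
        rwa [insert_sdiff_of_notMem _ (by simpa using hzx)])
    (fun _ h => h.1)).matroid

theorem genericLift_indep_iff {γ : Type*} (N : Matroid γ) [N.Finite] (D : Set γ) {I : Set γ} :
    (N.genericLift D).Indep I ↔
      I ⊆ N.E ∧ (N.Indep I ∨ ∃ x ∈ I, x ∈ D ∧ N.Indep (I \ {x})) := by
  simp [genericLift]

theorem genericLift_ground {γ : Type*} (N : Matroid γ) [N.Finite] (D : Set γ) :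
    (N.genericLift D).E = N.E := by
  simp [genericLift]

/-- The element of `M` whose line through the tip contains a given element other than the tip. -/
def coneUnder {α : Type*} {m : ℕ} : ConeElt α m → Option α
  | .base e => some e
  | .copy e _ => some e
  | .tip => none

theorem coneSet_finite {α : Type*} (m : ℕ) {S : Set α} (hS : S.Finite) :
    (coneSet m S).Finite := by
  refine ((hS.image ConeElt.base).union
    (((hS.prod (finite_univ (α := Fin m))).image fun p => ConeElt.copy p.1 p.2).union
      (finite_singleton (ConeElt.tip : ConeElt α m)))).subset ?_
  rintro x (rfl | ⟨e, he, rfl | ⟨i, rfl⟩⟩)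
  · exact Or.inr (Or.inr rfl)
  · exact Or.inl ⟨e, he, rfl⟩
  · exact Or.inr (Or.inl ⟨(e, i), ⟨he, mem_univ i⟩, rfl⟩)

/-- The matroid on `E(Q)` in which the tip is a loop and the elements of `T_e` are parallel
to `e`. -/
def coneAux {α : Type*} (M : Matroid α) (m : ℕ) : Matroid (ConeElt α m) :=
  (M.map some (Option.some_injective α).injOn).comapOn (coneSet m M.E) coneUnder

instance coneAux_finite {α : Type*} (M : Matroid α) [M.Finite] (m : ℕ) :
    (M.coneAux m).Finite :=
  ⟨coneSet_finite m M.ground_finite⟩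

section Aux

variable {α : Type*} {M : Matroid α} {m : ℕ}

theorem tip_mem_coneSet (S : Set α) : (ConeElt.tip : ConeElt α m) ∈ coneSet m S := Or.inl rfl

theorem base_mem_coneSet {S : Set α} {e : α} :
    (ConeElt.base e : ConeElt α m) ∈ coneSet m S ↔ e ∈ S := by
  simp [coneSet]

theorem copy_mem_coneSet {S : Set α} {e : α} {i : Fin m} :
    (ConeElt.copy e i : ConeElt α m) ∈ coneSet m S ↔ e ∈ S := by
  simp [coneSet]

theorem base_injective : Function.Injective (ConeElt.base : α → ConeElt α m) :=
  fun _ _ h => ConeElt.base.inj h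

theorem image_base_subset_coneSet (S : Set α) :
    (ConeElt.base '' S : Set (ConeElt α m)) ⊆ coneSet m S := by
  rintro _ ⟨e, he, rfl⟩
  exact base_mem_coneSet.2 he

theorem coneUnder_image_base (I : Set α) :
    coneUnder '' (ConeElt.base '' I : Set (ConeElt α m)) = some '' I := by
  rw [image_image]; rfl

theorem coneAux_indep_base {I : Set α} :
    (M.coneAux m).Indep (ConeElt.base '' I) ↔ M.Indep I := by
  rw [coneAux, comapOn_indep_iff, coneUnder_image_base]
  constructor
  · rintro ⟨h1, -, h3⟩
    have hI : I ⊆ M.E := fun e he => base_mem_coneSet.1 (h3 ⟨e, he, rfl⟩)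
    exact (map_image_indep_iff hI).1 h1
  · intro h
    refine ⟨h.map _ _, ?_, ?_⟩
    · rintro _ ⟨e, -, rfl⟩ _ ⟨f, -, rfl⟩ hef
      rw [Option.some.inj hef]
    · exact (image_mono h.subset_ground).trans (image_base_subset_coneSet _)

theorem coneAux_indep_copy {I : Set α} {e : α} (i : Fin m) (heI : e ∉ I)
    (h : M.Indep (insert e I)) :
    (M.coneAux m).Indep (insert (ConeElt.copy e i) (ConeElt.base '' I)) := by
  rw [coneAux, comapOn_indep_iff, image_insert_eq, coneUnder_image_base]
  have h0 : coneUnder (ConeElt.copy e i) = some e := rfl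
  refine ⟨?_, ?_, ?_⟩
  · rw [h0, ← image_insert_eq]
    exact h.map _ _
  · rintro _ (rfl | ⟨f, hf, rfl⟩) _ (rfl | ⟨g, hg, rfl⟩) hfg
    · rfl
    · exact absurd (Option.some.inj hfg ▸ hg) heI
    · exact absurd (Option.some.inj hfg ▸ hf) heI
    · rw [Option.some.inj hfg]
  · refine insert_subset (copy_mem_coneSet.2 (h.subset_ground (mem_insert _ _))) ?_
    exact (image_mono ((subset_insert e I).trans h.subset_ground)).trans
      (image_base_subset_coneSet _)

theorem coneAux_tip_notMem {J : Set (ConeElt α m)} (h : (M.coneAux m).Indep J) :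
    ConeElt.tip ∉ J := by
  intro hJ
  rw [coneAux, comapOn_indep_iff] at h
  obtain ⟨e, -, he⟩ := h.1.subset_ground (mem_image_of_mem coneUnder hJ)
  exact Option.some_ne_none e he

theorem coneAux_not_both {J : Set (ConeElt α m)} (h : (M.coneAux m).Indep J) {e : α}
    {i : Fin m} (h1 : ConeElt.base e ∈ J) (h2 : ConeElt.copy e i ∈ J) : False := by
  rw [coneAux, comapOn_indep_iff] at h
  exact absurd (h.2.1 h1 h2 rfl) (by simp)

end Aux

/-- The free `m`-cone through its independent sets. -/
noncomputable def coneMatroid {α : Type*} (M : Matroid α) [M.Finite] (m : ℕ) :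
    Matroid (ConeElt α m) :=
  (M.coneAux m).genericLift (range ConeElt.base)ᶜ

section Cone

variable {α : Type*} {M : Matroid α} [M.Finite] {m : ℕ}

theorem coneMatroid_ground : (M.coneMatroid m).E = coneSet m M.E :=
  genericLift_ground _ _

theorem coneMatroid_indep_of_aux {J : Set (ConeElt α m)} (h : (M.coneAux m).Indep J) :
    (M.coneMatroid m).Indep J :=
  (genericLift_indep_iff _ _).2 ⟨h.subset_ground, Or.inl h⟩

theorem coneMatroid_indep_insert {J : Set (ConeElt α m)} (h : (M.coneAux m).Indep J)
    {x : ConeElt α m} (hx : x ∈ coneSet m M.E) (hxb : x ∉ range ConeElt.base) :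
    (M.coneMatroid m).Indep (insert x J) := by
  refine (genericLift_indep_iff _ _).2 ⟨insert_subset hx h.subset_ground, ?_⟩
  by_cases hxJ : x ∈ J
  · rw [insert_eq_of_mem hxJ]; exact Or.inl h
  · exact Or.inr ⟨x, mem_insert _ _, hxb, by rwa [insert_sdiff_self_of_notMem hxJ]⟩

theorem tip_notMem_range : (ConeElt.tip : ConeElt α m) ∉ range ConeElt.base := by simp

theorem copy_notMem_range (e : α) (i : Fin m) :
    (ConeElt.copy e i : ConeElt α m) ∉ range ConeElt.base := by simp

theorem coneMatroid_indep_base {I : Set α} :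
    (M.coneMatroid m).Indep (ConeElt.base '' I) ↔ M.Indep I := by
  refine ⟨fun h => ?_, fun h => coneMatroid_indep_of_aux (coneAux_indep_base.2 h)⟩
  rcases ((genericLift_indep_iff _ _).1 h).2 with h | ⟨x, ⟨e, -, rfl⟩, hx, -⟩
  · exact coneAux_indep_base.1 h
  · exact absurd (mem_range_self e) hx

theorem coneAux_of_insert_tip {J : Set (ConeElt α m)} (hJ : ConeElt.tip ∉ J)
    (h : (M.coneMatroid m).Indep (insert ConeElt.tip J)) : (M.coneAux m).Indep J := by
  rcases ((genericLift_indep_iff _ _).1 h).2 with h | ⟨x, hx, hxb, h⟩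
  · exact absurd (mem_insert _ _) (coneAux_tip_notMem h)
  · by_cases hxt : x = ConeElt.tip
    · subst hxt
      rwa [insert_sdiff_self_of_notMem hJ] at h
    · exact absurd ⟨mem_insert _ _, fun h' => hxt (h' : _ = _).symm⟩ (coneAux_tip_notMem h)

/-- On the elements of `M`, the closure in the cone is the closure in `M`. -/
theorem base_mem_closure_iff {X : Set α} (hX : X ⊆ M.E) {e : α} :
    ConeElt.base e ∈ (M.coneMatroid m).closure (ConeElt.base '' X) ↔ e ∈ M.closure X := by
  obtain ⟨B, hB⟩ := M.exists_isBasis X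
  have hQB : (M.coneMatroid m).Indep (ConeElt.base '' B) := coneMatroid_indep_base.2 hB.indep
  have key : ∀ f, ConeElt.base f ∈ (M.coneMatroid m).closure (ConeElt.base '' B) ↔
      f ∈ M.closure B := by
    intro f
    rw [hQB.mem_closure_iff', hB.indep.mem_closure_iff', coneMatroid_ground, base_mem_coneSet,
      ← image_insert_eq, coneMatroid_indep_base, base_injective.mem_set_image]
  have hcl : (M.coneMatroid m).closure (ConeElt.base '' X) =
      (M.coneMatroid m).closure (ConeElt.base '' B) := by
    refine subset_antisymm ?_ ((M.coneMatroid m).closure_subset_closure (image_mono hB.subset))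
    refine closure_subset_closure_of_subset_closure ?_
    rintro _ ⟨f, hf, rfl⟩
    exact (key f).2 (hB.subset_closure hf)
  rw [hcl, key, hB.closure_eq_closure]

theorem coneMatroid_isBasis_base {X B : Set α} (hB : M.IsBasis B X) :
    (M.coneMatroid m).IsBasis (ConeElt.base '' B) (ConeElt.base '' X) := by
  refine (coneMatroid_indep_base.2 hB.indep).isBasis_of_subset_of_subset_closure
    (image_mono hB.subset) ?_
  rintro _ ⟨f, hf, rfl⟩
  exact (base_mem_closure_iff hB.indep.subset_ground).2 (hB.subset_closure hf)

theorem coneMatroid_line [M.Loopless] {e : α} (he : e ∈ M.E) (i : Fin m) :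
    ConeElt.tip ∈ (M.coneMatroid m).closure {ConeElt.base e, ConeElt.copy e i} ∧
    ConeElt.base e ∈ (M.coneMatroid m).closure {ConeElt.copy e i, ConeElt.tip} ∧
    ConeElt.copy e i ∈ (M.coneMatroid m).closure {ConeElt.base e, ConeElt.tip} := by
  have hie : M.Indep {e} := indep_singleton.2 (isNonloop_of_loopless he)
  have hb : (M.coneAux m).Indep {ConeElt.base e} := by
    rw [← image_singleton]; exact coneAux_indep_base.2 hie
  have hc : (M.coneAux m).Indep {ConeElt.copy e i} := by
    have := coneAux_indep_copy (M := M) (I := ∅) (e := e) i (notMem_empty _) (by simpa using hie)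
    simpa using this
  have hmt : (ConeElt.tip : ConeElt α m) ∈ coneSet m M.E := tip_mem_coneSet _
  have hmb : (ConeElt.base e : ConeElt α m) ∈ coneSet m M.E := base_mem_coneSet.2 he
  have hmc : (ConeElt.copy e i : ConeElt α m) ∈ coneSet m M.E := copy_mem_coneSet.2 he
  have h1 : (M.coneMatroid m).Indep {ConeElt.base e, ConeElt.copy e i} := by
    rw [pair_comm]; exact coneMatroid_indep_insert hb hmc (copy_notMem_range e i)
  have h2 : (M.coneMatroid m).Indep {ConeElt.copy e i, ConeElt.tip} := by
    rw [pair_comm]; exact coneMatroid_indep_insert hc hmt tip_notMem_range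
  have h3 : (M.coneMatroid m).Indep {ConeElt.base e, ConeElt.tip} := by
    rw [pair_comm]; exact coneMatroid_indep_insert hb hmt tip_notMem_range
  have hnot : ¬ (M.coneMatroid m).Indep
      (insert ConeElt.tip {ConeElt.base e, ConeElt.copy e i}) := fun h =>
    coneAux_not_both (e := e) (i := i) (coneAux_of_insert_tip (by simp) h) (by simp) (by simp)
  refine ⟨?_, ?_, ?_⟩
  · rw [h1.mem_closure_iff', coneMatroid_ground]
    exact ⟨hmt, fun h => absurd h hnot⟩
  · rw [h2.mem_closure_iff', coneMatroid_ground]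
    refine ⟨hmb, fun h => absurd ?_ hnot⟩
    convert h using 1
    ext x; simp; tauto
  · rw [h3.mem_closure_iff', coneMatroid_ground]
    refine ⟨hmc, fun h => absurd ?_ hnot⟩
    convert h using 1
    ext x; simp; tauto

theorem coneMatroid_isBasis_cone [M.Loopless] {F B : Set α} (hB : M.IsBasis B F) :
    (M.coneMatroid m).IsBasis (insert ConeElt.tip (ConeElt.base '' B)) (coneSet m F) := by
  have hF : F ⊆ M.E := hB.subset_ground
  have hind : (M.coneMatroid m).Indep (insert ConeElt.tip (ConeElt.base '' B)) :=
    coneMatroid_indep_insert (coneAux_indep_base.2 hB.indep) (tip_mem_coneSet _)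
      tip_notMem_range
  have htip : ConeElt.tip ∈
      (M.coneMatroid m).closure (insert ConeElt.tip (ConeElt.base '' B)) :=
    mem_closure_of_mem _ (mem_insert _ _) hind.subset_ground
  have hbase : ∀ f ∈ F, ConeElt.base f ∈
      (M.coneMatroid m).closure (insert ConeElt.tip (ConeElt.base '' B)) := fun f hf =>
    (M.coneMatroid m).closure_subset_closure (subset_insert _ _)
      ((base_mem_closure_iff hB.indep.subset_ground).2 (hB.subset_closure hf))
  refine hind.isBasis_of_subset_of_subset_closure ?_ ?_
  · exact insert_subset (tip_mem_coneSet _)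
      ((image_mono hB.subset).trans (image_base_subset_coneSet _))
  · rintro x (rfl | ⟨e, he, rfl | ⟨i, rfl⟩⟩)
    · exact htip
    · exact hbase e he
    · refine closure_subset_closure_of_subset_closure ?_ (coneMatroid_line (hF he) i).2.2
      exact insert_subset (hbase e he) (singleton_subset_iff.2 htip)

theorem coneMatroid_isFlat_base {X : Set α} (hX : M.IsFlat X) :
    (M.coneMatroid m).IsFlat (ConeElt.base '' X) := by
  have hXE : (ConeElt.base '' X : Set (ConeElt α m)) ⊆ (M.coneMatroid m).E := by
    rw [coneMatroid_ground]
    exact (image_mono hX.subset_ground).trans (image_base_subset_coneSet _)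
  refine isFlat_iff_closure_eq.2 (subset_antisymm ?_ (subset_closure _ _ hXE))
  obtain ⟨B, hB⟩ := M.exists_isBasis X hX.subset_ground
  have hQB := coneMatroid_isBasis_base (m := m) hB
  intro y hy
  by_cases hyb : y ∈ range ConeElt.base
  · obtain ⟨e, rfl⟩ := hyb
    have := (base_mem_closure_iff hX.subset_ground).1 hy
    rw [hX.closure] at this
    exact ⟨e, this, rfl⟩
  · exfalso
    rw [← hQB.closure_eq_closure, hQB.indep.mem_closure_iff', coneMatroid_ground] at hy
    obtain ⟨e, -, rfl⟩ :=
      hy.2 (coneMatroid_indep_insert (coneAux_indep_base.2 hB.indep) hy.1 hyb)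
    exact hyb (mem_range_self e)

theorem coneMatroid_isFlat_cone [M.Loopless] {F : Set α} (hF : M.IsFlat F) :
    (M.coneMatroid m).IsFlat (coneSet m F) := by
  obtain ⟨B, hB⟩ := M.exists_isBasis F hF.subset_ground
  have hQB := coneMatroid_isBasis_cone (m := m) hB
  refine isFlat_iff_closure_eq.2 (subset_antisymm ?_ (subset_closure _ _ hQB.subset_ground))
  intro y hy
  rw [← hQB.closure_eq_closure, hQB.indep.mem_closure_iff', coneMatroid_ground] at hy
  have hins : ∀ e ∈ M.E, e ∉ F → M.Indep (insert e B) ∧ e ∉ B := fun e he heF => by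
    have : e ∉ M.closure B := by rwa [hB.closure_eq_closure, hF.closure]
    exact (hB.indep.notMem_closure_iff he).1 this
  obtain ⟨hyE, hy⟩ := hy
  rw [insert_comm] at hy
  rcases hyE with rfl | ⟨e, he, rfl | ⟨i, rfl⟩⟩
  · exact tip_mem_coneSet F
  · rw [base_mem_coneSet]
    by_contra heF
    obtain ⟨h1, h2⟩ := hins e he heF
    have := hy (coneMatroid_indep_insert
      (by rw [← image_insert_eq]; exact coneAux_indep_base.2 h1) (tip_mem_coneSet _)
      tip_notMem_range)
    simp [h2] at this
  · rw [copy_mem_coneSet]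
    by_contra heF
    obtain ⟨h1, h2⟩ := hins e he heF
    have := hy (coneMatroid_indep_insert (coneAux_indep_copy i h2 h1) (tip_mem_coneSet _)
      tip_notMem_range)
    simp at this

theorem coneMatroid_isCyclicFlat_base {X : Set α} (hX : M.IsCyclicFlat X) :
    (M.coneMatroid m).IsCyclicFlat (ConeElt.base '' X) := by
  rw [isCyclicFlat_iff_closure] at hX ⊢
  refine ⟨coneMatroid_isFlat_base hX.1, ?_⟩
  rintro _ ⟨e, he, rfl⟩
  rw [← image_singleton, ← image_sdiff base_injective]
  exact (base_mem_closure_iff (sdiff_subset.trans hX.1.subset_ground)).2 (hX.2 e he)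

theorem coneMatroid_isCyclicFlat_cone [M.Loopless] (hm : 1 ≤ m) {F : Set α} (hF : M.IsFlat F)
    (hF0 : F.Nonempty) : (M.coneMatroid m).IsCyclicFlat (coneSet m F) := by
  refine isCyclicFlat_iff_closure.2 ⟨coneMatroid_isFlat_cone hF, ?_⟩
  have step : ∀ x y z : ConeElt α m, x ∈ (M.coneMatroid m).closure {y, z} →
      y ∈ coneSet m F → z ∈ coneSet m F → y ≠ x → z ≠ x →
      x ∈ (M.coneMatroid m).closure (coneSet m F \ {x}) := fun x y z h hy hz hyx hzx =>
    (M.coneMatroid m).closure_subset_closure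
      (show {y, z} ⊆ coneSet m F \ {x} from
        insert_subset ⟨hy, hyx⟩ (singleton_subset_iff.2 ⟨hz, hzx⟩)) h
  rintro x (rfl | ⟨e, he, rfl | ⟨i, rfl⟩⟩)
  · obtain ⟨e, he⟩ := hF0
    exact step _ _ _ (coneMatroid_line (hF.subset_ground he) ⟨0, hm⟩).1
      (base_mem_coneSet.2 he) (copy_mem_coneSet.2 he) (by simp) (by simp)
  · exact step _ _ _ (coneMatroid_line (hF.subset_ground he) ⟨0, hm⟩).2.1
      (copy_mem_coneSet.2 he) (tip_mem_coneSet F) (by simp) (by simp)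
  · exact step _ _ _ (coneMatroid_line (hF.subset_ground he) i).2.2
      (base_mem_coneSet.2 he) (tip_mem_coneSet F) (by simp) (by simp)

theorem coneMatroid_isCyclicFlat_cases [M.Loopless] {Z : Set (ConeElt α m)}
    (hZ : (M.coneMatroid m).IsCyclicFlat Z) :
    (∃ X, M.IsCyclicFlat X ∧ Z = ConeElt.base '' X) ∨
      ∃ F, M.IsFlat F ∧ F.Nonempty ∧ Z = coneSet m F := by
  rw [isCyclicFlat_iff_closure] at hZ
  obtain ⟨hZ, hcyc⟩ := hZ
  have hZE := hZ.subset_ground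
  have hclZ : ∀ {A : Set (ConeElt α m)}, A ⊆ Z → (M.coneMatroid m).closure A ⊆ Z := fun hA => by
    have := (M.coneMatroid m).closure_subset_closure hA
    rwa [hZ.closure] at this
  have hXE : ConeElt.base ⁻¹' Z ⊆ M.E := fun e he => by
    have := hZE he
    rwa [coneMatroid_ground, base_mem_coneSet] at this
  have hX : M.IsFlat (ConeElt.base ⁻¹' Z) := by
    refine isFlat_iff_closure_eq.2 (subset_antisymm ?_ (subset_closure _ _ hXE))
    intro e he
    exact hclZ (image_preimage_subset _ _) ((base_mem_closure_iff hXE).2 he)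
  by_cases hZb : Z ⊆ range ConeElt.base
  · left
    have hZX : Z = ConeElt.base '' (ConeElt.base ⁻¹' Z) :=
      (image_preimage_eq_of_subset hZb).symm
    refine ⟨_, isCyclicFlat_iff_closure.2 ⟨hX, fun e he => ?_⟩, hZX⟩
    rw [← base_mem_closure_iff (m := m) (sdiff_subset.trans hXE), image_sdiff base_injective,
      ← hZX, image_singleton]
    exact hcyc _ he
  · right
    obtain ⟨x, hxZ, hxb⟩ := not_subset.1 hZb
    have htip : ConeElt.tip ∈ Z := by
      obtain ⟨C, hCs, hC, hxC⟩ := exists_isCircuit_of_mem_closure (hcyc x hxZ) (by simp)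
      have hCZ : C \ {x} ⊆ Z := fun y hy => ((hCs hy.1).resolve_left hy.2).1
      by_contra htZ
      have htC : ConeElt.tip ∉ C \ {x} := fun h => htZ (hCZ h)
      have hCx := hC.sdiff_singleton_indep hxC
      have : ConeElt.tip ∉ (M.coneMatroid m).closure (C \ {x}) := fun h => htZ (hclZ hCZ h)
      have h1 := (hCx.notMem_closure_iff
        (by rw [coneMatroid_ground]; exact tip_mem_coneSet _)).1 this
      have h2 := coneMatroid_indep_insert (coneAux_of_insert_tip htC h1.1)
        (by rw [← coneMatroid_ground]; exact hZE hxZ) hxb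
      rw [insert_sdiff_singleton, insert_eq_of_mem hxC] at h2
      exact hC.not_indep h2
    have hZq : Z = coneSet m (ConeElt.base ⁻¹' Z) := by
      refine subset_antisymm (fun y hy => ?_) ?_
      · have hyE := hZE hy
        rw [coneMatroid_ground] at hyE
        rcases hyE with rfl | ⟨e, he, rfl | ⟨i, rfl⟩⟩
        · exact tip_mem_coneSet _
        · exact base_mem_coneSet.2 hy
        · exact copy_mem_coneSet.2 (hclZ (insert_subset hy (singleton_subset_iff.2 htip))
            (coneMatroid_line he i).2.1)
      · rintro y (rfl | ⟨e, he, rfl | ⟨i, rfl⟩⟩)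
        · exact htip
        · exact he
        · exact hclZ (insert_subset he (singleton_subset_iff.2 htip))
            (coneMatroid_line (hXE he) i).2.2
    refine ⟨_, hX, ?_, hZq⟩
    by_contra h0
    rw [not_nonempty_iff_eq_empty] at h0
    have hZt : Z = {ConeElt.tip} := by
      rw [hZq, h0]
      ext y
      simp [coneSet]
    have h1 := hcyc _ htip
    have h2 : (M.coneMatroid m).Indep (insert ConeElt.tip ∅) :=
      coneMatroid_indep_insert (empty_indep _) (tip_mem_coneSet _) tip_notMem_range
    rw [hZt, sdiff_self] at h1
    have h3 := ((empty_indep (M.coneMatroid m)).mem_closure_iff'.1 h1).2 h2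
    exact h3

theorem coneMatroid_isFreeCone (M : Matroid α) [M.Finite] [M.Loopless] (hm : 1 ≤ m) :
    M.IsFreeCone m (M.coneMatroid m) where
  ground_eq := coneMatroid_ground
  isCyclicFlat_iff Z := by
    refine ⟨coneMatroid_isCyclicFlat_cases, ?_⟩
    rintro (⟨X, hX, rfl⟩ | ⟨F, hF, hF0, rfl⟩)
    · exact coneMatroid_isCyclicFlat_base hX
    · exact coneMatroid_isCyclicFlat_cone hm hF hF0
  eRk_base X hX := by
    obtain ⟨B, hB⟩ := M.exists_isBasis X hX.1.subset_ground
    rw [(coneMatroid_isBasis_base hB).eRk_eq_encard, hB.eRk_eq_encard,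
      base_injective.encard_image]
  eRk_cone F hF _ := by
    obtain ⟨B, hB⟩ := M.exists_isBasis F hF.subset_ground
    rw [(coneMatroid_isBasis_cone hB).eRk_eq_encard, hB.eRk_eq_encard,
      encard_insert_of_notMem (by simp), base_injective.encard_image]

end Cone

theorem existsUnique_isFreeCone {α : Type*} (M : Matroid α) [M.Finite] [M.Loopless] {m : ℕ}
    (hm : 1 ≤ m) : ∃! Q : Matroid (ConeElt α m), M.IsFreeCone m Q := by
  refine ⟨_, coneMatroid_isFreeCone M hm, fun Q hQ => ?_⟩
  have h1 : Q.Finite := ⟨by rw [hQ.ground_eq]; exact coneSet_finite m M.ground_finite⟩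
  have h2 : (M.coneMatroid m).Finite :=
    ⟨by rw [coneMatroid_ground]; exact coneSet_finite m M.ground_finite⟩
  exact hQ.unique (coneMatroid_isFreeCone M hm)

/-- The *free `m`-cone* `Q_m(M)` of a finite loopless matroid `M`, for `m ≥ 1`: the unique matroid
with the ground set, the cyclic flats and the ranks of cyclic flats listed in `IsFreeCone`. -/
noncomputable def freeCone {α : Type*} (M : Matroid α) [M.Finite] [M.Loopless] (m : ℕ)
    (hm : 1 ≤ m) : Matroid (ConeElt α m) :=
  (M.existsUnique_isFreeCone hm).choose

theorem freeCone_isFreeCone {α : Type*} (M : Matroid α) [M.Finite] [M.Loopless] (m : ℕ)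
    (hm : 1 ≤ m) : M.IsFreeCone m (M.freeCone m hm) :=
  (M.existsUnique_isFreeCone hm).choose_spec.1

instance freeCone_finite {α : Type*} (M : Matroid α) [M.Finite] [M.Loopless] (m : ℕ)
    (hm : 1 ≤ m) : (M.freeCone m hm).Finite :=
  ⟨by rw [(M.freeCone_isFreeCone m hm).ground_eq]; exact coneSet_finite m M.ground_finite⟩

end Matroid

/-!
Write `Q` for the free `m`-cone of `M`, and let the shadow of a set `A` of elements of `Q` be the set
`S` of those elements of `M` whose line through the tip meets `A` outside the tip. Since `Q` is the
generic elementary lift `coneMatroid` of a matroid in which the tip is a loop and every copy of `e`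
is parallel to `e`, the rank of `A` in `Q` is `r(S)` or `r(S) + 1`, and it is `r(S)` exactly when
every element of `A` outside `E(M)` is the only element of `A` over a coloop of `M|S`
(`coneMatroid_eRk`).

Hence the sizes and ranks of the sets with shadow `S`, even of those avoiding prescribed kinds of
elements (base elements, tip), depend only on `r(S)`, on `|S|` and on the number `c(S)` of coloops:
numbering `S` with its coloops first carries these sets to sets with shadow `{0, …, |S| - 1}`,
in a way that preserves size and rank (`liftData_eq_range`). Adding up over all `S` shows that the
size-rank-coloop data of `M` determines the multiset of pairs `(|A|, r(A))` of the deletion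
(`sizeRankData_coneMatroid_delete`), and this multiset determines the Tutte polynomial, the rank of
the deletion being the largest second entry (`tuttePolynomial_eq_sum_sizeRankData`).
-/

namespace Matroid

open Set

/-! ### The rank function of a generic lift and of the free cone -/

theorem genericLift_eRk_of_forall_isColoop {γ : Type*} {N : Matroid γ} [N.Finite] {D A : Set γ}
    (hA : A ⊆ N.E) (h : ∀ x ∈ A, x ∈ D → (N ↾ A).IsColoop x) :
    (N.genericLift D).eRk A = N.eRk A := by
  apply le_antisymm
  · rw [eRk_le_iff]
    intro I hIA hI
    refine Indep.encard_le_eRk_of_subset ?_ hIA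
    rcases ((genericLift_indep_iff _ _).1 hI).2 with hI | ⟨x, hxI, hxD, hI⟩
    · exact hI
    · have hx := ((restrict_isColoop_iff hA).1 (h x (hIA hxI) hxD)).1
      have hx' : x ∉ N.closure (I \ {x}) := fun hx' =>
        hx (N.closure_subset_closure (sdiff_subset_sdiff_left hIA) hx')
      have := ((hI.notMem_closure_iff (hA (hIA hxI))).1 hx').1
      rwa [insert_sdiff_singleton, insert_eq_of_mem hxI] at this
  · rw [eRk_le_iff]
    intro I hIA hI
    exact Indep.encard_le_eRk_of_subset
      ((genericLift_indep_iff _ _).2 ⟨hI.subset_ground, Or.inl hI⟩) hIA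

/-- A generic lift raises the rank of a set exactly when one of the lifted elements in the set is
in the closure of the others: a basis avoiding this element can then be extended by it. -/
theorem genericLift_eRk_of_not_isColoop {γ : Type*} {N : Matroid γ} [N.Finite] {D A : Set γ}
    (hA : A ⊆ N.E) {x : γ} (hxA : x ∈ A) (hxD : x ∈ D) (hx : ¬ (N ↾ A).IsColoop x) :
    (N.genericLift D).eRk A = N.eRk A + 1 := by
  apply le_antisymm
  · rw [eRk_le_iff]
    intro I hIA hI
    rcases ((genericLift_indep_iff _ _).1 hI).2 with hI | ⟨y, hyI, -, hI⟩
    · exact (hI.encard_le_eRk_of_subset hIA).trans le_self_add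
    · rw [← encard_sdiff_singleton_add_one hyI]
      gcongr
      exact hI.encard_le_eRk_of_subset (sdiff_subset.trans hIA)
  · have hcl : x ∈ N.closure (A \ {x}) := by
      by_contra hcon
      exact hx ((restrict_isColoop_iff hA).2 ⟨hcon, hxA⟩)
    obtain ⟨B, hB⟩ := N.exists_isBasis (A \ {x}) (sdiff_subset.trans hA)
    have hxB : x ∉ B := fun h => (hB.subset h).2 rfl
    have hr : N.eRk A = B.encard := by
      rw [← hB.eRk_eq_encard, ← eRk_closure_eq, ← eRk_closure_eq N (A \ {x}),
        ← closure_insert_eq_of_mem_closure hcl, insert_sdiff_singleton, insert_eq_of_mem hxA]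
    rw [hr, ← encard_insert_of_notMem hxB]
    refine Indep.encard_le_eRk_of_subset ((genericLift_indep_iff _ _).2 ⟨?_, Or.inr
      ⟨x, mem_insert _ _, hxD, ?_⟩⟩) ?_
    · exact insert_subset (hA hxA) hB.indep.subset_ground
    · rw [insert_sdiff_self_of_notMem hxB]; exact hB.indep
    · exact insert_subset hxA (hB.subset.trans sdiff_subset)

/-- The *shadow* of a set `A` of elements of a free cone: the elements of the base matroid whose
line through the tip meets `A` outside the tip. -/
def shadow {α : Type*} {m : ℕ} (A : Set (ConeElt α m)) : Set α :=
  {e | ∃ x ∈ A, coneUnder x = some e}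

/-- `A` is *thin* over `C` if every element of `A` that is not in the base matroid lies over an
element of `C` and is the only element of `A` over it. In particular, `A` avoids the tip. -/
def IsThin {α : Type*} {m : ℕ} (C : Set α) (A : Set (ConeElt α m)) : Prop :=
  ∀ x ∈ A, x ∉ range ConeElt.base →
    ∃ e ∈ C, coneUnder x = some e ∧ ∀ y ∈ A, coneUnder y = some e → y = x

section Rank

variable {α : Type*} {M : Matroid α} {m : ℕ} {A : Set (ConeElt α m)}

theorem shadow_eq_preimage (A : Set (ConeElt α m)) : shadow A = some ⁻¹' (coneUnder '' A) := rfl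

theorem shadow_subset_iff {S : Set α} : shadow A ⊆ S ↔ A ⊆ coneSet m S := by
  constructor
  · rintro h (e | ⟨e, i⟩ | _) hx
    · exact base_mem_coneSet.2 (h ⟨_, hx, rfl⟩)
    · exact copy_mem_coneSet.2 (h ⟨_, hx, rfl⟩)
    · exact tip_mem_coneSet _
  · rintro h e ⟨x, hx, hxe⟩
    cases x with
    | base f => cases hxe; exact base_mem_coneSet.1 (h hx)
    | copy f i => cases hxe; exact copy_mem_coneSet.1 (h hx)
    | tip => cases hxe

theorem coneAux_eRk (hA : A ⊆ coneSet m M.E) : (M.coneAux m).eRk A = M.eRk (shadow A) := by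
  have hS : shadow A ⊆ M.E := shadow_subset_iff.2 hA
  rw [coneAux, comapOn, restrict_eRk_eq _ hA, eRk_comap, ← eRk_inter_ground, map_ground,
    ← eRk_map M (Option.some_injective α).injOn hS]
  congr 1
  ext o
  constructor
  · rintro ⟨⟨x, hx, rfl⟩, e, he, hxe⟩
    exact ⟨e, ⟨x, hx, hxe.symm⟩, hxe⟩
  · rintro ⟨e, ⟨x, hx, hxe⟩, rfl⟩
    exact ⟨⟨x, hx, hxe⟩, e, hS ⟨x, hx, hxe⟩, rfl⟩

theorem mem_coneAux_closure_iff (hA : A ⊆ coneSet m M.E) {x : ConeElt α m} {e : α}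
    (hx : coneUnder x = some e) (he : e ∈ M.E) :
    x ∈ (M.coneAux m).closure A ↔ e ∈ M.closure (shadow A) := by
  have hxE : x ∈ coneSet m M.E := by
    cases x with
    | base f => cases hx; exact base_mem_coneSet.2 he
    | copy f i => cases hx; exact copy_mem_coneSet.2 he
    | tip => cases hx
  rw [coneAux, comapOn, restrict_closure_eq', comap_closure_eq, map_closure_eq,
    inter_eq_self_of_subset_left hA]
  simp [hx, hxE, he, shadow_eq_preimage]

theorem coneAux_isColoop_iff (hA : A ⊆ coneSet m M.E) {x : ConeElt α m} (hxA : x ∈ A) :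
    ((M.coneAux m) ↾ A).IsColoop x ↔ ∃ e ∈ (M ↾ shadow A).coloops, coneUnder x = some e ∧
      ∀ y ∈ A, coneUnder y = some e → y = x := by
  have hS : shadow A ⊆ M.E := shadow_subset_iff.2 hA
  rw [restrict_isColoop_iff hA]
  simp only [← isColoop_iff_mem_coloops, restrict_isColoop_iff hS]
  cases hx : coneUnder x with
  | none =>
    -- The tip is a loop of `coneAux`, so it is never a coloop of a restriction.
    simp only [reduceCtorEq, false_and, and_false, exists_false, iff_false, not_and]
    intro h
    refine absurd ?_ h
    rw [coneAux, comapOn, restrict_closure_eq']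
    exact Or.inr ⟨hA hxA, by simp [hx]⟩
  | some e =>
    have heS : e ∈ shadow A := ⟨x, hxA, hx⟩
    rw [mem_coneAux_closure_iff (sdiff_subset.trans hA) hx (hS heS)]
    constructor
    · rintro ⟨h, -⟩
      have huniq : ∀ y ∈ A, coneUnder y = some e → y = x := by
        intro y hy hye
        by_contra hne
        exact h (M.mem_closure_of_mem ⟨y, ⟨hy, hne⟩, hye⟩
          ((shadow_subset_iff.2 (sdiff_subset.trans hA))))
      refine ⟨e, ⟨fun h' => h (M.closure_subset_closure ?_ h'), heS⟩, rfl, huniq⟩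
      rintro f ⟨⟨y, hy, hyf⟩, hfe⟩
      refine ⟨y, ⟨hy, ?_⟩, hyf⟩
      rintro rfl
      rw [hx] at hyf
      exact hfe (Option.some.inj hyf).symm
    · rintro ⟨f, ⟨h, -⟩, hef, huniq⟩
      obtain rfl := Option.some.inj hef
      refine ⟨fun h' => h (M.closure_subset_closure ?_ h'), hxA⟩
      rintro f ⟨y, ⟨hy, hyx⟩, hyf⟩
      refine ⟨⟨y, hy, hyf⟩, ?_⟩
      rintro rfl
      exact hyx (huniq y hy hyf)

open scoped Classical in
/-- The rank function of the free cone: a set has the rank of its shadow, plus one unless every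
element outside the base is alone on its line over a coloop of the shadow. -/
theorem coneMatroid_eRk [M.Finite] (hA : A ⊆ coneSet m M.E) :
    (M.coneMatroid m).eRk A =
      M.eRk (shadow A) + if IsThin (M ↾ shadow A).coloops A then 0 else 1 := by
  rw [coneMatroid, ← coneAux_eRk hA]
  split_ifs with h
  · rw [add_zero]
    exact genericLift_eRk_of_forall_isColoop hA fun x hx hxb =>
      (coneAux_isColoop_iff hA hx).2 (h x hx hxb)
  · simp only [IsThin, not_forall] at h
    obtain ⟨x, hx, hxb, h⟩ := h
    exact genericLift_eRk_of_not_isColoop hA hx hxb fun h' =>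
      h ((coneAux_isColoop_iff hA hx).1 h')

end Rank

end Matroid

/-! ### Relabelling the elements of a cone -/

/-- Relabelling of the elements of a free cone along a map of the elements of the base. -/
def ConeElt.map {α β : Type*} {m : ℕ} (h : α → β) : ConeElt α m → ConeElt β m
  | .base e => .base (h e)
  | .copy e i => .copy (h e) i
  | .tip => .tip

/-- The kind of an element of a free cone: a base element, the tip, or an `i`-th copy. -/
def ConeElt.kind {α : Type*} {m : ℕ} : ConeElt α m → ConeElt Unit m :=
  ConeElt.map fun _ => ()

namespace Matroid

open Set

section Map

variable {α β : Type*} {m : ℕ} {h : α → β} {S C : Set α} {A : Set (ConeElt α m)}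

theorem kind_map (x : ConeElt α m) : (x.map h).kind = x.kind := by
  cases x <;> rfl

theorem coneUnder_map (x : ConeElt α m) : coneUnder (x.map h) = (coneUnder x).map h := by
  cases x <;> rfl

theorem map_mem_range_base {x : ConeElt α m} :
    x.map h ∈ range (ConeElt.base : β → ConeElt β m) ↔ x ∈ range ConeElt.base := by
  cases x <;> simp [ConeElt.map]

theorem shadow_image_map : shadow (ConeElt.map h '' A) = h '' shadow A := by
  ext f
  constructor
  · rintro ⟨_, ⟨x, hx, rfl⟩, hxf⟩
    rw [coneUnder_map, Option.map_eq_some_iff] at hxf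
    obtain ⟨e, hxe, rfl⟩ := hxf
    exact ⟨e, ⟨x, hx, hxe⟩, rfl⟩
  · rintro ⟨e, ⟨x, hx, hxe⟩, rfl⟩
    exact ⟨_, ⟨x, hx, rfl⟩, by rw [coneUnder_map, hxe]; rfl⟩

theorem injOn_map_coneSet (hh : InjOn h S) : InjOn (ConeElt.map h) (coneSet m S) := by
  rintro (e | ⟨e, i⟩ | _) hx (f | ⟨f, j⟩ | _) hy hxy <;> simp_all [ConeElt.map]
  · exact hh (base_mem_coneSet.1 hx) (base_mem_coneSet.1 hy) hxy
  · exact hh (copy_mem_coneSet.1 hx) (copy_mem_coneSet.1 hy) hxy.1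

theorem image_map_coneSet : ConeElt.map h '' coneSet m S = coneSet m (h '' S) := by
  ext y
  constructor
  · rintro ⟨x, hx, rfl⟩
    cases x with
    | base e => exact base_mem_coneSet.2 ⟨e, base_mem_coneSet.1 hx, rfl⟩
    | copy e i => exact copy_mem_coneSet.2 ⟨e, copy_mem_coneSet.1 hx, rfl⟩
    | tip => exact tip_mem_coneSet _
  · rintro (rfl | ⟨_, ⟨e, he, rfl⟩, rfl | ⟨i, rfl⟩⟩)
    · exact ⟨_, tip_mem_coneSet S, rfl⟩
    · exact ⟨_, base_mem_coneSet.2 he, rfl⟩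
    · exact ⟨_, copy_mem_coneSet.2 he, rfl⟩

theorem isThin_image_map (hh : InjOn h S) (hC : C ⊆ S) (hA : shadow A ⊆ S) :
    IsThin (h '' C) (ConeElt.map h '' A) ↔ IsThin C A := by
  have hAS := shadow_subset_iff.1 hA
  simp only [IsThin, forall_mem_image, exists_mem_image, map_mem_range_base, coneUnder_map]
  refine forall₃_congr fun x hx _ => exists_congr fun e => and_congr_right fun heC => ?_
  have key : ∀ y ∈ A, (coneUnder y).map h = some (h e) ↔ coneUnder y = some e := by
    intro y hy
    rw [Option.map_eq_some_iff]
    constructor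
    · rintro ⟨f, hyf, hfe⟩
      rw [hyf, hh (hA ⟨y, hy, hyf⟩) (hC heC) hfe]
    · intro hye
      exact ⟨e, hye, rfl⟩
  refine and_congr (key x hx) (forall₂_congr fun y hy => ?_)
  rw [key y hy, (injOn_map_coneSet hh).eq_iff (hAS hy) (hAS hx)]

end Map

/-! ### Counting the sets with a given shadow -/

/-- A finite set can be numbered with the elements of a given subset first. -/
theorem exists_injOn_image_eq_range {α : Type*} {S : Finset α} {C : Set α} (hC : C ⊆ S) :
    ∃ h : α → ℕ, InjOn h S ∧ h '' S = Iio S.card ∧ h '' C = Iio C.ncard := by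
  classical
  have hCf := S.finite_toSet.subset hC
  have hDf : ((S : Set α) \ C).Finite := S.finite_toSet.sdiff
  have hcard : ((S : Set α) \ C).ncard + C.ncard = S.card := by
    rw [ncard_sdiff_add_ncard_of_subset hC, ncard_coe_finset]
  obtain ⟨f, hf⟩ := hCf.exists_bijOn_of_encard_eq (t := Iio C.ncard) (by
    rw [← hCf.cast_ncard_eq, ← (finite_Iio _).cast_ncard_eq, ← Finset.coe_Iio,
      ncard_coe_finset, Nat.card_Iio])
  obtain ⟨g, hg⟩ := hDf.exists_bijOn_of_encard_eq (t := Ico C.ncard S.card) (by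
    rw [← hDf.cast_ncard_eq, ← (finite_Ico _ _).cast_ncard_eq, ← Finset.coe_Ico,
      ncard_coe_finset, Nat.card_Ico, ← hcard, Nat.add_sub_cancel])
  have hf' : BijOn (C.piecewise f g) C (Iio C.ncard) :=
    hf.congr (piecewise_eqOn C f g).symm
  have hg' : BijOn (C.piecewise f g) (S \ C) (Ico C.ncard S.card) :=
    hg.congr fun x hx => (piecewise_eq_of_notMem C f g hx.2).symm
  have hdisj : Disjoint (Iio C.ncard) (Ico C.ncard S.card) := by
    rw [disjoint_left]
    exact fun k hk hk' => absurd hk (not_lt.2 hk'.1)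
  have hS := hf'.union hg' ((injOn_union disjoint_sdiff_right).2 ⟨hf'.injOn, hg'.injOn,
    fun x hx y hy => hdisj.ne_of_mem (hf'.mapsTo hx) (hg'.mapsTo hy)⟩)
  rw [union_sdiff_cancel hC, Iio_union_Ico_eq_Iio (by omega)] at hS
  exact ⟨_, hS.injOn, hS.image_eq, hf'.image_eq⟩

section Lifts

open scoped Classical

variable {α β : Type*} {m : ℕ} {h : α → β} {K : Set (ConeElt Unit m)} {S : Finset α} {C : Set α}

/-- The sets with shadow `S` that have no element of a kind in `K`. -/
noncomputable def lifts (K : Set (ConeElt Unit m)) (S : Finset α) : Finset (Finset (ConeElt α m)) :=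
  {A ∈ (coneSet_finite m S.finite_toSet).toFinset.powerset |
    shadow (A : Set (ConeElt α m)) = S ∧ ∀ x ∈ A, x.kind ∉ K}

theorem mem_lifts {A : Finset (ConeElt α m)} :
    A ∈ lifts K S ↔ shadow (A : Set (ConeElt α m)) = S ∧ ∀ x ∈ A, x.kind ∉ K := by
  rw [lifts, Finset.mem_filter, and_iff_right_iff_imp, Finset.mem_powerset,
    ← Finset.coe_subset, Finite.coe_toFinset]
  exact fun hA => shadow_subset_iff.1 hA.1.subset

/-- The multiset of the sizes and the ranks in the free cone of the members of `lifts K S`, for a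
set `S` of rank `r` in the base whose restriction has the set `C` of coloops. -/
noncomputable def liftData (K : Set (ConeElt Unit m)) (S : Finset α) (C : Set α) (r : ℕ) :
    Multiset (ℕ × ℕ) :=
  (lifts K S).val.map fun (A : Finset (ConeElt α m)) =>
    (A.card, r + if IsThin C (A : Set (ConeElt α m)) then 0 else 1)

theorem lifts_image [DecidableEq β] (hh : InjOn h S) :
    lifts K (S.image h) = (lifts K S).image (Finset.image (ConeElt.map h)) := by
  ext B
  simp only [Finset.mem_image, mem_lifts]
  constructor
  · rintro ⟨hBS, hBK⟩
    have hB : (B : Set (ConeElt β m)) ⊆ ConeElt.map h '' coneSet m S := by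
      rw [image_map_coneSet, ← Finset.coe_image]
      exact shadow_subset_iff.1 hBS.subset
    obtain ⟨A, hAS, rfl⟩ := Finset.subset_set_image_iff.1 hB
    refine ⟨A, ⟨?_, fun x hx => ?_⟩, rfl⟩
    · rw [Finset.coe_image, shadow_image_map, Finset.coe_image] at hBS
      exact (hh.image_eq_image_iff (shadow_subset_iff.2 hAS) Subset.rfl).1 hBS
    · rw [← kind_map (h := h)]
      exact hBK _ (Finset.mem_image_of_mem _ hx)
  · rintro ⟨A, ⟨hAS, hAK⟩, rfl⟩
    refine ⟨by rw [Finset.coe_image, shadow_image_map, hAS, Finset.coe_image], ?_⟩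
    simpa only [Finset.forall_mem_image, kind_map] using hAK

theorem liftData_image [DecidableEq β] (hh : InjOn h S) (hC : C ⊆ S) (r : ℕ) :
    liftData K (S.image h) (h '' C) r = liftData K S C r := by
  have hsub : ∀ A ∈ lifts K S, (A : Set (ConeElt α m)) ⊆ coneSet m S := fun A hA =>
    shadow_subset_iff.1 (mem_lifts.1 hA).1.subset
  have hinj : InjOn (Finset.image (ConeElt.map h)) (lifts K S : Set (Finset (ConeElt α m))) := by
    intro A hA B hB hAB
    rw [← Finset.coe_inj, Finset.coe_image, Finset.coe_image] at hAB
    exact Finset.coe_inj.1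
      (((injOn_map_coneSet hh).image_eq_image_iff (hsub A hA) (hsub B hB)).1 hAB)
  rw [liftData, lifts_image hh, Finset.image_val_of_injOn hinj, Multiset.map_map, liftData]
  refine Multiset.map_congr rfl fun A hA => ?_
  have hAS := mem_lifts.1 (show A ∈ lifts K S from hA)
  rw [Function.comp_apply, Finset.card_image_of_injOn
    ((injOn_map_coneSet hh).mono (hsub A hA)), Finset.coe_image,
    isThin_image_map hh hC hAS.1.subset]

/-- The pairs in `liftData` depend only on the sizes of `S` and `C` and on `r`. -/
theorem liftData_eq_range (hC : C ⊆ S) (r : ℕ) :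
    liftData K S C r = liftData K (Finset.range S.card) (Iio C.ncard) r := by
  obtain ⟨h, hh, hS, hCh⟩ := exists_injOn_image_eq_range hC
  rw [← liftData_image hh hC, hCh]
  congr 1
  rw [← Finset.coe_inj, Finset.coe_image, hS, Finset.coe_range]

end Lifts

/-! ### Tutte polynomials of deletions of the free cone -/

/-- The multiset of the pairs `(|S|, r(S))` over all subsets `S` of the ground set. -/
noncomputable def sizeRankData {α : Type*} (M : Matroid α) [M.Finite] : Multiset (ℕ × ℕ) :=
  M.ground_finite.toFinset.powerset.val.map fun (S : Finset α) =>
    (S.card, (M.eRk (S : Set α)).toNat)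

theorem sup_sizeRankData {α : Type*} (M : Matroid α) [M.Finite] :
    (M.sizeRankData.map Prod.snd).sup = M.eRank.toNat := by
  have htop : M.eRank ≠ ⊤ := M.eRank_ne_top_iff.2 inferInstance
  apply le_antisymm
  · rw [Multiset.sup_le]
    intro k hk
    simp only [sizeRankData, Multiset.map_map, Multiset.mem_map] at hk
    obtain ⟨S, -, rfl⟩ := hk
    exact ENat.toNat_le_toNat (M.eRk_le_eRank _) htop
  · apply Multiset.le_sup
    simp only [sizeRankData, Multiset.map_map, Multiset.mem_map]
    refine ⟨M.ground_finite.toFinset, by simp, ?_⟩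
    simp

theorem tuttePolynomial_eq_sum_sizeRankData {α : Type*} (M : Matroid α) [M.Finite] :
    M.tuttePolynomial = (M.sizeRankData.map fun p =>
      (MvPolynomial.X 0 - 1) ^ ((M.sizeRankData.map Prod.snd).sup - p.2) *
        (MvPolynomial.X 1 - 1) ^ (p.1 - p.2)).sum := by
  rw [sup_sizeRankData, sizeRankData, Multiset.map_map]
  rfl

open scoped Classical in
/-- Deleting from the cone all elements of the kinds in `K` leaves a matroid whose sizes and ranks
of sets are determined by the size-rank-coloop data of the base. Only the part of `D` inside the
ground set of the cone matters. -/
theorem sizeRankData_coneMatroid_delete {α : Type*} (M : Matroid α) [M.Finite] {m : ℕ}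
    (K : Set (ConeElt Unit m)) {D : Set (ConeElt α m)} [(M.coneMatroid m ＼ D).Finite]
    (hD : ∀ x ∈ coneSet m M.E, x ∈ D ↔ x.kind ∈ K) :
    (M.coneMatroid m ＼ D).sizeRankData = M.sizeRankColoopData.bind fun t =>
      liftData K (Finset.range t.1) (Iio t.2.2) t.2.1 := by
  have hG : ∀ A : Finset (ConeElt α m),
      A ∈ (M.coneMatroid m ＼ D).ground_finite.toFinset.powerset ↔
        shadow (A : Set (ConeElt α m)) ⊆ M.E ∧ ∀ x ∈ A, x.kind ∉ K := by
    intro A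
    rw [Finset.mem_powerset, ← Finset.coe_subset, Finite.coe_toFinset, delete_ground,
      coneMatroid_ground, subset_sdiff, shadow_subset_iff]
    refine and_congr_right fun hA => ?_
    rw [disjoint_left]
    exact forall₂_congr fun x hx => not_congr (hD x (hA hx))
  let g : Finset (ConeElt α m) → Finset α := fun A =>
    {e ∈ M.ground_finite.toFinset | e ∈ shadow (A : Set (ConeElt α m))}
  have hg : ∀ A ∈ (M.coneMatroid m ＼ D).ground_finite.toFinset.powerset,
      g A ∈ M.ground_finite.toFinset.powerset := fun A _ =>
    Finset.mem_powerset.2 (Finset.filter_subset _ _)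
  have hfib : ∀ S ∈ M.ground_finite.toFinset.powerset,
      {A ∈ (M.coneMatroid m ＼ D).ground_finite.toFinset.powerset | g A = S} = lifts K S := by
    intro S hS
    rw [Finset.mem_powerset, ← Finset.coe_subset, Finite.coe_toFinset] at hS
    ext A
    rw [Finset.mem_filter, hG, mem_lifts, ← Finset.coe_inj, Finset.coe_filter]
    have : ∀ T : Set α, {e | e ∈ M.ground_finite.toFinset ∧ e ∈ T} = M.E ∩ T := by
      intro T; ext; simp
    rw [this]
    constructor
    · rintro ⟨⟨h1, h2⟩, h3⟩
      exact ⟨by rwa [inter_eq_self_of_subset_right h1] at h3, h2⟩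
    · rintro ⟨h1, h2⟩
      exact ⟨⟨h1.subset.trans hS, h2⟩, by rw [h1, inter_eq_self_of_subset_right hS]⟩
  have hsum : ∀ (s : Finset (Finset (ConeElt α m))) (f : Finset (ConeElt α m) → ℕ × ℕ),
      s.val.map f = ∑ A ∈ s, {f A} := fun s f => by
    rw [← Multiset.sum_map_singleton (s.val.map f), Multiset.map_map]
    rfl
  -- Group the subsets of the ground set by their shadows.
  rw [sizeRankData, hsum, sizeRankColoopData, Multiset.bind_map,
    ← Finset.sum_fiberwise_of_maps_to hg]
  refine Finset.sum_congr rfl fun S hS => ?_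
  rw [hfib S hS]
  have hSE : (S : Set α) ⊆ M.E := by
    rwa [Finset.mem_powerset, ← Finset.coe_subset, Finite.coe_toFinset] at hS
  rw [← liftData_eq_range (C := (M ↾ (S : Set α)).coloops) (coloops_subset_ground _),
    liftData, hsum]
  refine Finset.sum_congr rfl fun A hA => ?_
  have hAS := (mem_lifts.1 hA).1
  have hAG := (Finset.mem_filter.1 ((hfib S hS).symm ▸ hA)).1
  have hAG' := (Finset.mem_powerset.1 hAG)
  rw [← Finset.coe_subset, Finite.coe_toFinset] at hAG'
  have hfin : M.eRk (S : Set α) ≠ ⊤ :=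
    ((M.eRk_le_encard _).trans_lt S.finite_toSet.encard_lt_top).ne
  have hr : (M.coneMatroid m ＼ D).eRk A = (M.coneMatroid m).eRk A :=
    restrict_eRk_eq _ hAG'
  rw [hr, coneMatroid_eRk (shadow_subset_iff.1 (hAS.subset.trans hSE)), hAS, ENat.toNat_add hfin]
  · split_ifs <;> rfl
  · split_ifs <;> simp

theorem freeCone_eq_coneMatroid {α : Type*} (M : Matroid α) [M.Finite] [M.Loopless] {m : ℕ}
    (hm : 1 ≤ m) : M.freeCone m hm = M.coneMatroid m :=
  (M.existsUnique_isFreeCone hm).unique (M.freeCone_isFreeCone m hm) (coneMatroid_isFreeCone M hm)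

theorem tuttePolynomial_freeCone_delete_eq {α β : Type*}
    (M : Matroid α) [M.Finite] [M.Loopless] (N : Matroid β) [N.Finite] [N.Loopless]
    {m : ℕ} (hm : 1 ≤ m) (h : M.sizeRankColoopData = N.sizeRankColoopData)
    (K : Set (ConeElt Unit m)) {D : Set (ConeElt α m)} {D' : Set (ConeElt β m)}
    (hD : ∀ x ∈ coneSet m M.E, x ∈ D ↔ x.kind ∈ K)
    (hD' : ∀ x ∈ coneSet m N.E, x ∈ D' ↔ x.kind ∈ K) :
    (M.freeCone m hm ＼ D).tuttePolynomial = (N.freeCone m hm ＼ D').tuttePolynomial := by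
  have key : (M.freeCone m hm ＼ D).sizeRankData = (N.freeCone m hm ＼ D').sizeRankData := by
    simp only [freeCone_eq_coneMatroid]
    have h1 : (M.coneMatroid m ＼ D).Finite := by
      rw [← freeCone_eq_coneMatroid M hm]; infer_instance
    have h2 : (N.coneMatroid m ＼ D').Finite := by
      rw [← freeCone_eq_coneMatroid N hm]; infer_instance
    rw [sizeRankData_coneMatroid_delete M K hD, sizeRankData_coneMatroid_delete N K hD', h]
  rw [tuttePolynomial_eq_sum_sizeRankData, tuttePolynomial_eq_sum_sizeRankData, key]

end Matroid

theorem corollary5p2 {α β : Type*}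
    (M : Matroid α) [M.Finite] [M.Loopless]
    (N : Matroid β) [N.Finite] [N.Loopless]
    (m : ℕ) (hm : 1 ≤ m)
    (h : M.sizeRankColoopData = N.sizeRankColoopData) :
    (M.freeCone m hm ＼ {ConeElt.tip}).tuttePolynomial =
        (N.freeCone m hm ＼ {ConeElt.tip}).tuttePolynomial ∧
      (M.freeCone m hm ＼ (ConeElt.base '' M.E)).tuttePolynomial =
        (N.freeCone m hm ＼ (ConeElt.base '' N.E)).tuttePolynomial ∧
      (M.freeCone m hm ＼ (ConeElt.base '' M.E ∪ {ConeElt.tip})).tuttePolynomial =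
        (N.freeCone m hm ＼ (ConeElt.base '' N.E ∪ {ConeElt.tip})).tuttePolynomial := by
  refine ⟨Matroid.tuttePolynomial_freeCone_delete_eq M N hm h {ConeElt.tip} ?_ ?_,
    Matroid.tuttePolynomial_freeCone_delete_eq M N hm h {ConeElt.base ()} ?_ ?_,
    Matroid.tuttePolynomial_freeCone_delete_eq M N hm h {ConeElt.base (), ConeElt.tip} ?_ ?_⟩ <;>
  · rintro (e | ⟨e, i⟩ | _) he <;>
      simp_all [ConeElt.kind, ConeElt.map, Matroid.base_mem_coneSet]
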